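/- For measurable $g:\mathbb R\to[0,\infty]$ let $g^*(t)=\int_0^\infty \chi_{(0,|\{g>r\}|)}(t)\,dr$, $t>0$, be its decreasing rearrangement. For a measurable $f:\mathbb R^2\to\mathbb R$, the two-dimensional rearrangement $f_2^*(s,t)$, $s,t>0$, is obtained by rearranging $|f(x,\cdot)|$ in the second variable for each fixed $x$, and then rearranging the result in the first variable for each fixed $t$: $f_2^*(s,t)=(f_y^*(\cdot,t))_x^*(s)$, where $f_y^*(x,t)=(|f(x,\cdot)|)^*(t)$. Proposition. Let $v:(0,\infty)\to[0,\infty)$ be decreasing (not necessarily strictly). Then for every measurable function $f:\mathbb R^2\to\mathbb R$, $$\sup_{h_2^*=v}\int_{\mathbb R^2} f(x,y)\,h(x,y)\,dx\,dy =\sup_{h_2^*=v}\int_{\mathbb R^2} |f(x,y)\,h(x,y)|\,dx\,dy =\int_0^\infty\!\!\int_0^\infty f_2^*(s,t)\,v(t)\,ds\,dt ,$$ as an equality in $[0,\infty]$. Both suprema run over the measurable $h:\mathbb R^2\to\mathbb R$ with $h_2^*(s,t)=v(t)$ for almost every $(s,t)\in(0,\infty)^2$; in the first one, over those among them for which the integral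 of $fh$ exists in $[-\infty,\infty]$ (that is, the positive or the negative part of $fh$ has finite integral). -/

import Mathlib

open MeasureTheory Set
open scoped ENNReal

/-- The layer cake rearrangement of a nonnegative function `g` on `X` with respect to a
transformation `R` from sets in `X` to sets in `Y`:
`g_R^*(y) = ∫_0^∞ χ_{R({g > r})}(y) dr`. -/
noncomputable def layerCakeRearrangement {X Y : Type*} (R : Set X → Set Y)
    (g : X → ℝ≥0∞) (y : Y) : ℝ≥0∞ :=
  ∫⁻ r in Ioi (0 : ℝ), (R {x | ENNReal.ofReal r < g x}).indicator (fun _ => (1 : ℝ≥0∞)) y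

/-- The set transformation `E ↦ (0, |E|)` on the real line, `|E|` being Lebesgue measure. -/
def intervalTransform (E : Set ℝ) : Set ℝ :=
  {t | 0 < t ∧ ENNReal.ofReal t < volume E}

/-- The usual decreasing rearrangement `g^*` on `(0, ∞)` of a function `g ≥ 0` on `ℝ`. -/
noncomputable def decreasingRearrangement (g : ℝ → ℝ≥0∞) (t : ℝ) : ℝ≥0∞ :=
  layerCakeRearrangement intervalTransform g t

/-- The two-dimensional rearrangement of `f`, at `(s, t)` with `s, t > 0`: rearrange `|f|`
first with respect to `y` (for fixed `x`), then with respect to `x` (for fixed `t`). -/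
noncomputable def rearrangement₂ (f : ℝ × ℝ → ℝ) (s t : ℝ) : ℝ≥0∞ :=
  decreasingRearrangement (fun x => decreasingRearrangement (fun y => ‖f (x, y)‖ₑ) t) s

/-- `h` is a (Lebesgue) measurable function on the plane with `h_2^*(s, t) = v(t)` for almost
every `(s, t)` in the open first quadrant. -/
def HasRearrangement₂ (h : ℝ × ℝ → ℝ) (v : ℝ → ℝ) : Prop :=
  AEMeasurable h volume ∧
    ∀ᵐ p ∂((volume : Measure (ℝ × ℝ)).restrict (Ioi 0 ×ˢ Ioi 0)),
      rearrangement₂ h p.1 p.2 = ENNReal.ofReal (v p.2)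

/-- The integral of `g` over the plane exists in `[-∞, ∞]`:
its positive or its negative part has finite integral. -/
def ExtIntegralExists (g : ℝ × ℝ → ℝ) : Prop :=
  (∫⁻ p, ENNReal.ofReal (g p)) ≠ ∞ ∨ (∫⁻ p, ENNReal.ofReal (-g p)) ≠ ∞

/-- The integral of `g` over the plane with values in `[-∞, ∞]`, as the integral of the positive
part minus that of the negative part; meaningful when `ExtIntegralExists g`. -/
noncomputable def extIntegral (g : ℝ × ℝ → ℝ) : EReal :=
  ((∫⁻ p, ENNReal.ofReal (g p) : ℝ≥0∞) : EReal) -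
    ((∫⁻ p, ENNReal.ofReal (-g p) : ℝ≥0∞) : EReal)

/-! Since `v` depends on `t` alone, equimeasurability in `s` removes the outer rearrangement: the
right-hand side is `∫ dx ∫ f_y^*(x,t) v(t) dt` (`lintegral_quadrant_decreasingRearrangement`). The
problem then splits into one-dimensional ones on the lines `x = const`.

Upper bound: `h_2^*(·,t)` is constant in `s`, so for a.e. `t` one has `h_y^*(x,t) ≤ v(t)` for a.e.
`x` (`ae_le_of_decreasingRearrangement_ae_eq`). Hardy–Littlewood on each line finishes.

Lower bound: prescribing `h_2^* = v` only requires `h_y^*(x,·) ≤ v` everywhere and equality on a set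
of `x` of infinite measure. So `h` can be chosen freely, subject to the inequality, for `|x| ≤ n`,
while the columns `|x| > n` carry the fixed profile `v(2|y|)`. For `|x| ≤ n`, `|h(x,·)|` is `v`
composed with the rank of `y` in a strict ordering of `[-n,n]` compatible with a dyadic truncation
of `|f(x,·)|`. The rank map is measure preserving (`map_rankOn`), which gives the reverse
Hardy–Littlewood inequality `lintegral_decreasingRearrangement_mul_le`. Giving `h` the sign of `f`
makes `fh ≥ 0`, so the same `h` serves both suprema, and `n → ∞` follows by monotone convergence. -/

/-! ### One-dimensional decreasing rearrangement: basic properties. -/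

lemma lintegral_indicator_ofReal_lt (c : ℝ≥0∞) :
    ∫⁻ r in Ioi (0 : ℝ), {r : ℝ | ENNReal.ofReal r < c}.indicator (fun _ => (1 : ℝ≥0∞)) r = c := by
  have hm : MeasurableSet {r : ℝ | ENNReal.ofReal r < c} :=
    measurableSet_lt ENNReal.measurable_ofReal measurable_const
  rw [lintegral_indicator_const hm, one_mul, Measure.restrict_apply hm]
  rcases eq_or_ne c ∞ with rfl | hc
  · have : {r : ℝ | ENNReal.ofReal r < ∞} ∩ Ioi 0 = Ioi 0 := by
      ext r; simp
    rw [this, Real.volume_Ioi]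
  · have : {r : ℝ | ENNReal.ofReal r < c} ∩ Ioi 0 = Ioo 0 c.toReal := by
      ext r
      simp only [mem_inter_iff, mem_Ioi, mem_Ioo]
      constructor
      · rintro ⟨h1, h2⟩
        exact ⟨h2, (ENNReal.ofReal_lt_iff_lt_toReal h2.le hc).1 h1⟩
      · rintro ⟨h1, h2⟩
        exact ⟨(ENNReal.ofReal_lt_iff_lt_toReal h1.le hc).2 h2, h1⟩
    rw [this, Real.volume_Ioo, sub_zero, ENNReal.ofReal_toReal hc]

lemma decreasingRearrangement_eq (g : ℝ → ℝ≥0∞) {t : ℝ} (ht : 0 < t) :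
    decreasingRearrangement g t = ∫⁻ r in Ioi (0 : ℝ),
      {t : ℝ | ENNReal.ofReal t < volume {x | ENNReal.ofReal r < g x}}.indicator
        (fun _ => (1 : ℝ≥0∞)) t := by
  unfold decreasingRearrangement layerCakeRearrangement
  refine lintegral_congr fun r => ?_
  simp only [indicator, intervalTransform]
  congr 1
  simp [ht]

lemma antitone_volume_superlevel (g : ℝ → ℝ≥0∞) :
    Antitone fun r : ℝ => volume {x | ENNReal.ofReal r < g x} := fun _ _ h =>
  measure_mono fun _ hx => lt_of_le_of_lt (ENNReal.ofReal_le_ofReal h) hx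

/-- Together with `le_decreasingRearrangement`, this describes `g^*(t)` as the supremum of the
levels `r` with `|{g > r}| > t`; most later estimates use this form instead of the integral.
Measurability of `g` plays no role. -/
lemma decreasingRearrangement_le {g : ℝ → ℝ≥0∞} {t : ℝ} {c : ℝ≥0∞}
    (h : ∀ r > 0, ENNReal.ofReal t < volume {x | ENNReal.ofReal r < g x} → ENNReal.ofReal r ≤ c)
    (ht : 0 < t) : decreasingRearrangement g t ≤ c := by
  -- The hypothesis gives only `r ≤ c`, while the layer cake formula needs a strict inequality,
  -- hence the passage to `d > c`.
  refine le_of_forall_gt_imp_ge_of_dense fun d hd => ?_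
  rw [decreasingRearrangement_eq g ht, ← lintegral_indicator_ofReal_lt d]
  refine setLIntegral_mono_ae' measurableSet_Ioi (ae_of_all _ fun r hr => ?_)
  by_cases h1 : ENNReal.ofReal t < volume {x | ENNReal.ofReal r < g x}
  · have := (h r hr h1).trans_lt hd
    simp [indicator, h1, this]
  · simp [indicator, h1]

lemma le_decreasingRearrangement {g : ℝ → ℝ≥0∞} {t r : ℝ} (ht : 0 < t)
    (h : ENNReal.ofReal t < volume {x | ENNReal.ofReal r < g x}) :
    ENNReal.ofReal r ≤ decreasingRearrangement g t := by
  rw [decreasingRearrangement_eq g ht, ← lintegral_indicator_ofReal_lt (ENNReal.ofReal r)]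
  refine setLIntegral_mono_ae' measurableSet_Ioi (ae_of_all _ fun q hq => ?_)
  by_cases h1 : ENNReal.ofReal q < ENNReal.ofReal r
  · have h2 : q ≤ r := (ENNReal.ofReal_lt_ofReal_iff_of_nonneg (le_of_lt hq)).1 h1 |>.le
    have := h.trans_le (antitone_volume_superlevel g h2)
    simp only [indicator, mem_ofPred_eq, h1, this, le_refl]
  · simp only [indicator, mem_ofPred_eq, h1, if_false, zero_le]

lemma decreasingRearrangement_of_nonpos (g : ℝ → ℝ≥0∞) {t : ℝ} (ht : t ≤ 0) :
    decreasingRearrangement g t = 0 := by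
  simp [decreasingRearrangement, layerCakeRearrangement, intervalTransform, indicator, ht.not_gt]

lemma decreasingRearrangement_mono {g g' : ℝ → ℝ≥0∞} (h : ∀ x, g x ≤ g' x) (t : ℝ) :
    decreasingRearrangement g t ≤ decreasingRearrangement g' t := by
  rcases le_or_gt t 0 with ht | ht
  · simp [decreasingRearrangement_of_nonpos g ht]
  · exact decreasingRearrangement_le (fun r _ hr => le_decreasingRearrangement ht
      (hr.trans_le (measure_mono fun x hx => lt_of_lt_of_le hx (h x)))) ht

lemma decreasingRearrangement_congr {g g' : ℝ → ℝ≥0∞} (h : g =ᵐ[volume] g') (t : ℝ) :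
    decreasingRearrangement g t = decreasingRearrangement g' t := by
  rcases le_or_gt t 0 with ht | ht
  · simp [decreasingRearrangement_of_nonpos _ ht]
  · rw [decreasingRearrangement_eq _ ht, decreasingRearrangement_eq _ ht]
    have : ∀ r : ℝ, volume {x | ENNReal.ofReal r < g x} = volume {x | ENNReal.ofReal r < g' x} :=
      fun r => measure_congr (by
        filter_upwards [h] with x hx
        exact propext (by show ENNReal.ofReal r < g x ↔ ENNReal.ofReal r < g' x; rw [hx]))
    simp only [this]

/-- The strict superlevel sets of the supremum are increasing unions, so continuity of measure from
below puts any admissible level already under some `g n`. -/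
lemma decreasingRearrangement_iSup {g : ℕ → ℝ → ℝ≥0∞} (hg : Monotone g) (t : ℝ) :
    decreasingRearrangement (fun x => ⨆ n, g n x) t = ⨆ n, decreasingRearrangement (g n) t := by
  refine le_antisymm ?_ (iSup_le fun n => decreasingRearrangement_mono
    (fun x => le_iSup (fun n => g n x) n) t)
  rcases le_or_gt t 0 with ht | ht
  · simp [decreasingRearrangement_of_nonpos _ ht]
  · refine decreasingRearrangement_le (fun r _ hr => ?_) ht
    have h1 : {x | ENNReal.ofReal r < ⨆ n, g n x} = ⋃ n, {x | ENNReal.ofReal r < g n x} := by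
      ext x; simp [lt_iSup_iff]
    have hmono : Monotone fun n => {x | ENNReal.ofReal r < g n x} :=
      fun m n hmn x hx => lt_of_lt_of_le hx (hg hmn x)
    rw [h1, hmono.measure_iUnion, lt_iSup_iff] at hr
    obtain ⟨n, hn⟩ := hr
    exact (le_decreasingRearrangement ht hn).trans
      (le_iSup (fun n => decreasingRearrangement (g n) t) n)

/-- Joint measurability in parameter and `t` is what allows rearrangements to be iterated and
Tonelli to be applied to them. -/
lemma measurable_decreasingRearrangement {X : Type*} [MeasurableSpace X] {G : X × ℝ → ℝ≥0∞}
    (hG : Measurable G) :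
    Measurable fun p : X × ℝ => decreasingRearrangement (fun y => G (p.1, y)) p.2 := by
  have h1 : Measurable fun q : X × ℝ => volume {y | ENNReal.ofReal q.2 < G (q.1, y)} := by
    have : MeasurableSet {q : (X × ℝ) × ℝ | ENNReal.ofReal q.1.2 < G (q.1.1, q.2)} :=
      measurableSet_lt (by fun_prop) (by fun_prop)
    exact measurable_measure_prodMk_left this
  have h2 : MeasurableSet {q : (X × ℝ) × ℝ | 0 < q.1.2 ∧ ENNReal.ofReal q.1.2 <
      volume {y | ENNReal.ofReal q.2 < G (q.1.1, y)}} := by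
    have h3 : Measurable fun q : (X × ℝ) × ℝ =>
        volume {y | ENNReal.ofReal q.2 < G (q.1.1, y)} :=
      h1.comp (by fun_prop : Measurable fun q : (X × ℝ) × ℝ => (q.1.1, q.2))
    have h4 : MeasurableSet {q : (X × ℝ) × ℝ | 0 < q.1.2} :=
      measurableSet_lt measurable_const (by fun_prop)
    exact h4.inter (measurableSet_lt (by fun_prop) h3)
  exact ((measurable_const (a := (1 : ℝ≥0∞))).indicator h2).lintegral_prod_right'
    (ν := volume.restrict (Ioi (0 : ℝ)))

lemma measurable_decreasingRearrangement_apply {g : ℝ → ℝ≥0∞} (hg : Measurable g) :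
    Measurable (decreasingRearrangement g) :=
  (measurable_decreasingRearrangement (G := fun p : Unit × ℝ => g p.2) (by fun_prop)).comp
    (by fun_prop : Measurable fun t : ℝ => ((), t))

lemma measurableSet_superlevel {X : Type*} [MeasurableSpace X] {g : X → ℝ≥0∞}
    (hg : Measurable g) : MeasurableSet {p : X × ℝ | ENNReal.ofReal p.2 < g p.1} :=
  measurableSet_lt (by fun_prop) (by fun_prop)

/-- By Tonelli both sides equal `∫ |{g > r}| dr`. -/
lemma lintegral_decreasingRearrangement {g : ℝ → ℝ≥0∞} (hg : Measurable g) :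
    ∫⁻ t in Ioi (0 : ℝ), decreasingRearrangement g t = ∫⁻ x, g x := by
  have hμ : Measurable fun r : ℝ => volume {x | ENNReal.ofReal r < g x} :=
    (antitone_volume_superlevel g).measurable
  have e1 : ∀ x, g x = ∫⁻ r in Ioi (0 : ℝ),
      {p : ℝ × ℝ | ENNReal.ofReal p.2 < g p.1}.indicator (fun _ => (1 : ℝ≥0∞)) (x, r) :=
    fun x => (lintegral_indicator_ofReal_lt (g x)).symm
  calc ∫⁻ t in Ioi (0 : ℝ), decreasingRearrangement g t
      = ∫⁻ t in Ioi (0 : ℝ), ∫⁻ r in Ioi (0 : ℝ),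
        {t : ℝ | ENNReal.ofReal t < volume {x | ENNReal.ofReal r < g x}}.indicator
        (fun _ => (1 : ℝ≥0∞)) t :=
        setLIntegral_congr_fun measurableSet_Ioi fun t ht => decreasingRearrangement_eq g ht
    _ = ∫⁻ r in Ioi (0 : ℝ), ∫⁻ t in Ioi (0 : ℝ),
        {t : ℝ | ENNReal.ofReal t < volume {x | ENNReal.ofReal r < g x}}.indicator
        (fun _ => (1 : ℝ≥0∞)) t := by
        refine lintegral_lintegral_swap (Measurable.aemeasurable ?_)
        exact (measurable_const (a := (1 : ℝ≥0∞))).indicator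
          (measurableSet_lt (by fun_prop) (hμ.comp measurable_snd) :
            MeasurableSet {p : ℝ × ℝ | ENNReal.ofReal p.1 <
              volume {x | ENNReal.ofReal p.2 < g x}})
    _ = ∫⁻ r in Ioi (0 : ℝ), volume {x | ENNReal.ofReal r < g x} :=
        lintegral_congr fun r => lintegral_indicator_ofReal_lt _
    _ = ∫⁻ r in Ioi (0 : ℝ), ∫⁻ x,
        {p : ℝ × ℝ | ENNReal.ofReal p.2 < g p.1}.indicator (fun _ => (1 : ℝ≥0∞)) (x, r) := by
        refine lintegral_congr fun r => ?_
        have hm : MeasurableSet {x | ENNReal.ofReal r < g x} :=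
          measurableSet_lt measurable_const hg
        exact ((lintegral_indicator_const hm 1).trans (one_mul _)).symm
    _ = ∫⁻ x, ∫⁻ r in Ioi (0 : ℝ),
        {p : ℝ × ℝ | ENNReal.ofReal p.2 < g p.1}.indicator (fun _ => (1 : ℝ≥0∞)) (x, r) := by
        refine lintegral_lintegral_swap (Measurable.aemeasurable ?_)
        exact ((measurable_const (a := (1 : ℝ≥0∞))).indicator
          (measurableSet_superlevel hg)).comp measurable_swap
    _ = ∫⁻ x, g x := lintegral_congr fun x => (e1 x).symm

/-! ### Hardy–Littlewood inequality. -/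

/-- The rearrangement of `χ_E g` is at most `g^*` and vanishes for `t ≥ |E|`. This is
Hardy–Littlewood with one factor an indicator; the general case follows by slicing that factor into
its superlevel sets. -/
lemma setLIntegral_le_decreasingRearrangement {g : ℝ → ℝ≥0∞} (hg : Measurable g) {E : Set ℝ}
    (hE : MeasurableSet E) :
    ∫⁻ x in E, g x ≤ ∫⁻ t in Ioi (0 : ℝ),
      {t : ℝ | ENNReal.ofReal t < volume E}.indicator (decreasingRearrangement g) t := by
  rw [← lintegral_indicator hE, ← lintegral_decreasingRearrangement (hg.indicator hE)]
  refine setLIntegral_mono_ae' measurableSet_Ioi (ae_of_all _ fun t ht => ?_)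
  by_cases h : ENNReal.ofReal t < volume E
  · rw [indicator_of_mem (show t ∈ {t : ℝ | ENNReal.ofReal t < volume E} from h)]
    exact decreasingRearrangement_mono (fun x => indicator_le_self E g x) t
  · rw [indicator_of_notMem (show t ∉ {t : ℝ | ENNReal.ofReal t < volume E} from h)]
    refine decreasingRearrangement_le (fun r hr hlt => absurd (hlt.trans_le (measure_mono ?_)) h) ht
    intro x hx
    by_contra hxE
    have : ENNReal.ofReal r < E.indicator g x := hx
    simp [indicator_of_notMem hxE] at this

/-- The Hardy–Littlewood inequality. -/
lemma lintegral_mul_le_decreasingRearrangement {a b : ℝ → ℝ≥0∞} (ha : Measurable a)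
    (hb : Measurable b) :
    ∫⁻ x, a x * b x ≤
      ∫⁻ t in Ioi (0 : ℝ), decreasingRearrangement a t * decreasingRearrangement b t := by
  have hμ : Measurable fun r : ℝ => volume {x | ENNReal.ofReal r < a x} :=
    (antitone_volume_superlevel a).measurable
  have hS := measurableSet_superlevel ha
  have hT : MeasurableSet {p : ℝ × ℝ | ENNReal.ofReal p.2 <
      volume {x | ENNReal.ofReal p.1 < a x}} :=
    measurableSet_lt (by fun_prop) (hμ.comp measurable_fst)
  have hRb := measurable_decreasingRearrangement_apply hb
  calc ∫⁻ x, a x * b x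
      = ∫⁻ x, ∫⁻ r in Ioi (0 : ℝ), {p : ℝ × ℝ | ENNReal.ofReal p.2 < a p.1}.indicator
          (fun p => b p.1) (x, r) := by
        refine lintegral_congr fun x => ?_
        conv_lhs => rw [← lintegral_indicator_ofReal_lt (a x)]
        rw [← lintegral_mul_const]
        · refine lintegral_congr fun r => ?_
          by_cases h : ENNReal.ofReal r < a x <;> simp [indicator, h]
        · exact measurable_const.indicator
            (measurableSet_lt ENNReal.measurable_ofReal measurable_const)
    _ = ∫⁻ r in Ioi (0 : ℝ), ∫⁻ x, {p : ℝ × ℝ | ENNReal.ofReal p.2 < a p.1}.indicator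
          (fun p => b p.1) (x, r) := by
        refine lintegral_lintegral_swap (Measurable.aemeasurable ?_)
        exact (hb.comp measurable_fst).indicator hS
    _ ≤ ∫⁻ r in Ioi (0 : ℝ), ∫⁻ t in Ioi (0 : ℝ),
          {p : ℝ × ℝ | ENNReal.ofReal p.2 < volume {x | ENNReal.ofReal p.1 < a x}}.indicator
            (fun p => decreasingRearrangement b p.2) (r, t) := by
        refine lintegral_mono fun r => ?_
        have hm : MeasurableSet {x | ENNReal.ofReal r < a x} :=
          measurableSet_lt measurable_const ha
        have := setLIntegral_le_decreasingRearrangement hb hm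
        rw [← lintegral_indicator hm] at this
        exact this
    _ = ∫⁻ t in Ioi (0 : ℝ), ∫⁻ r in Ioi (0 : ℝ),
          {p : ℝ × ℝ | ENNReal.ofReal p.2 < volume {x | ENNReal.ofReal p.1 < a x}}.indicator
            (fun p => decreasingRearrangement b p.2) (r, t) := by
        refine lintegral_lintegral_swap (Measurable.aemeasurable ?_)
        exact (hRb.comp measurable_snd).indicator hT
    _ = ∫⁻ t in Ioi (0 : ℝ), decreasingRearrangement a t * decreasingRearrangement b t := by
        refine setLIntegral_congr_fun measurableSet_Ioi fun t ht => ?_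
        rw [decreasingRearrangement_eq a ht, ← lintegral_mul_const]
        · refine lintegral_congr fun r => ?_
          by_cases h : ENNReal.ofReal t < volume {x | ENNReal.ofReal r < a x} <;>
            simp [indicator, h]
        · exact measurable_const.indicator (measurableSet_lt measurable_const hμ)

/-! ### Probability integral transform. -/

lemma continuous_measureReal_Ioi (ν : Measure ℝ) [IsFiniteMeasure ν] [NullSingletonClass ν] :
    Continuous fun r : ℝ => ν.real (Ioi r) := by
  have h : ∀ r, ν.real (Ioi r) = ∫ x, (Ioi r).indicator (fun _ => (1 : ℝ)) x ∂ν := fun r => by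
    rw [integral_indicator_const _ measurableSet_Ioi, smul_eq_mul, mul_one]
  simp_rw [h]
  refine continuous_iff_continuousAt.2 fun r₀ => ?_
  refine continuousAt_of_dominated (bound := fun _ => 1) ?_ ?_ (integrable_const _) ?_
  · exact Filter.Eventually.of_forall fun r =>
      (measurable_const.indicator measurableSet_Ioi).aestronglyMeasurable
  · refine Filter.Eventually.of_forall fun r => ae_of_all _ fun x => ?_
    by_cases hx : r < x <;> simp [indicator, hx]
  · have hne : ∀ᵐ x ∂ν, x ≠ r₀ := by
      rw [ae_iff]; simp
    filter_upwards [hne] with x hx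
    rcases lt_or_gt_of_ne hx with hx | hx
    · have : (fun r => (Ioi r).indicator (fun _ => (1 : ℝ)) x) =ᶠ[nhds r₀] fun _ => 0 := by
        filter_upwards [Ioi_mem_nhds hx] with r hr
        simp [indicator, (mem_Ioi.1 hr).le]
      exact (continuousAt_congr this).2 continuousAt_const
    · have : (fun r => (Ioi r).indicator (fun _ => (1 : ℝ)) x) =ᶠ[nhds r₀] fun _ => 1 := by
        filter_upwards [Iio_mem_nhds hx] with r hr
        simp [indicator, mem_Iio.1 hr]
      exact (continuousAt_congr this).2 continuousAt_const

lemma measureReal_Ioi_eq_sub (ν : Measure ℝ) [IsFiniteMeasure ν] (r : ℝ) :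
    ν.real (Ioi r) = ν.real univ - ν.real (Iic r) := by
  rw [← compl_Iic, measureReal_compl measurableSet_Iic]

lemma tendsto_measureReal_Ioi_atTop (ν : Measure ℝ) [IsFiniteMeasure ν] :
    Filter.Tendsto (fun r : ℝ => ν.real (Ioi r)) Filter.atTop (nhds 0) := by
  simp_rw [measureReal_Ioi_eq_sub]
  have := (ENNReal.tendsto_toReal (measure_ne_top ν univ)).comp (tendsto_measure_Iic_atTop ν)
  simpa [Measure.real, Function.comp_def] using this.const_sub (ν.real univ)

lemma tendsto_measureReal_Ioi_atBot (ν : Measure ℝ) [IsFiniteMeasure ν] [NullSingletonClass ν] :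
    Filter.Tendsto (fun r : ℝ => ν.real (Ioi r)) Filter.atBot (nhds (ν.real univ)) := by
  have := (ENNReal.tendsto_toReal (measure_ne_top ν univ)).comp (tendsto_measure_Ici_atBot ν)
  refine this.congr fun r => ?_
  simp only [Function.comp, Measure.real]
  rw [Ioi_ae_eq_Ici.measure_eq]

/-- The probability integral transform: the tail function of an atomless finite measure carries
the measure to Lebesgue measure on an interval. -/
lemma map_measureReal_Ioi (ν : Measure ℝ) [IsFiniteMeasure ν] [NullSingletonClass ν] :
    ν.map (fun r : ℝ => ν.real (Ioi r)) = volume.restrict (Icc 0 (ν.real univ)) := by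
  have hc := continuous_measureReal_Ioi ν
  have htop := tendsto_measureReal_Ioi_atTop ν
  have hbot := tendsto_measureReal_Ioi_atBot ν
  have hanti : Antitone fun r : ℝ => ν.real (Ioi r) := fun a b h =>
    measureReal_mono (Ioi_subset_Ioi h)
  set T : ℝ → ℝ := fun r => ν.real (Ioi r) with hT
  set m := ν.real univ with hm
  have hνm : ν univ = ENNReal.ofReal m := by simp [hm]
  refine Measure.ext_of_Iic _ _ fun a => ?_
  rw [Measure.map_apply hc.measurable measurableSet_Iic, Measure.restrict_apply measurableSet_Iic]
  have hTm : ∀ r, T r ≤ m := fun r => measureReal_mono (subset_univ _)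
  have hT0 : ∀ r, 0 ≤ T r := fun r => measureReal_nonneg
  rcases lt_or_ge a 0 with ha | ha
  · have h1 : T ⁻¹' Iic a = ∅ := by
      ext r; simpa using ha.trans_le (hT0 r)
    have h2 : Iic a ∩ Icc 0 m = ∅ := by
      ext r; simp only [mem_inter_iff, mem_Iic, mem_Icc, mem_empty_iff_false, iff_false]
      rintro ⟨h, h', _⟩
      linarith
    rw [h1, h2]; simp
  rcases le_or_gt m a with hma | hma
  · have h1 : T ⁻¹' Iic a = univ := by
      ext r; simpa using (hTm r).trans hma
    have h2 : Iic a ∩ Icc 0 m = Icc 0 m := by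
      refine inter_eq_right.2 fun r hr => hr.2.trans hma
    rw [h1, h2, Real.volume_Icc, sub_zero, hνm]
  have h2 : Iic a ∩ Icc 0 m = Icc 0 a := by
    ext r; simp only [mem_inter_iff, mem_Iic, mem_Icc]
    constructor
    · rintro ⟨h, h', _⟩; exact ⟨h', h⟩
    · rintro ⟨h, h'⟩; exact ⟨h', h, h'.trans hma.le⟩
  rw [h2, Real.volume_Icc, sub_zero]
  rcases (T ⁻¹' Iic a).eq_empty_or_nonempty with he | hne
  · have : a ≤ 0 := ge_of_tendsto htop (Filter.Eventually.of_forall fun r => by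
      by_contra h
      have : r ∈ T ⁻¹' Iic a := (not_le.1 h).le
      simp [he] at this)
    rw [he, measure_empty, ENNReal.ofReal_of_nonpos this]
  have hcl : IsClosed (T ⁻¹' Iic a) := isClosed_Iic.preimage hc
  have hbdd : BddBelow (T ⁻¹' Iic a) := by
    obtain ⟨b, hb⟩ := (hbot.eventually (lt_mem_nhds hma)).exists
    refine ⟨b, fun r hr => ?_⟩
    by_contra h
    exact absurd (hanti (not_le.1 h).le) (not_le.2 (lt_of_le_of_lt hr hb))
  -- The leftmost point where the tail is at most `a`. Continuity from the left gives `T ρ = a`, so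
  -- the preimage `Ici ρ` has measure `a`, atoms being absent.
  set ρ := sInf (T ⁻¹' Iic a) with hρ
  have hmem : ρ ∈ T ⁻¹' Iic a := hcl.csInf_mem hne hbdd
  have hIci : T ⁻¹' Iic a = Ici ρ := by
    ext r
    exact ⟨fun hr => csInf_le hbdd hr, fun hr => (hanti hr).trans hmem⟩
  have hge : a ≤ T ρ := by
    have : Filter.Tendsto T (nhdsWithin ρ (Iio ρ)) (nhds (T ρ)) :=
      hc.continuousAt.tendsto.mono_left nhdsWithin_le_nhds
    refine ge_of_tendsto this ?_
    filter_upwards [self_mem_nhdsWithin] with r hr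
    by_contra h
    have : r ∈ T ⁻¹' Iic a := (not_le.1 h).le
    rw [hIci] at this
    exact absurd (mem_Iio.1 hr) (not_lt.2 (mem_Ici.1 this))
  have hTρ : T ρ = a := le_antisymm hmem hge
  rw [hIci, ← Ioi_ae_eq_Ici.measure_eq, ← hTρ]
  simp [hT]

/-! ### Measure-preserving ranks and the reverse Hardy–Littlewood inequality. -/

section Rank

/-- The measure of the part of `D` that strictly precedes `y` when points are ordered by
decreasing values of `u`. -/
noncomputable def rankOn (D : Set ℝ) (u : ℝ → ℝ) (y : ℝ) : ℝ :=
  (volume.restrict D).real {z | u y < u z}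

variable {D : Set ℝ} {u : ℝ → ℝ}

/-- The rank is the tail function of the law of `u` on `D`, evaluated at `u`. Injectivity makes that
law atomless, so the probability integral transform applies. -/
lemma map_rankOn (hDf : volume D ≠ ∞) (hu : Measurable u) (hinj : Function.Injective u) :
    (volume.restrict D).map (rankOn D u) = volume.restrict (Icc 0 (volume D).toReal) := by
  have : IsFiniteMeasure (volume.restrict D) := ⟨by simpa using hDf.lt_top⟩
  set ν := (volume.restrict D).map u with hν
  have : NullSingletonClass ν := ⟨fun c => by
    rw [hν, Measure.map_apply hu (measurableSet_singleton c)]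
    exact (subsingleton_singleton.preimage hinj).measure_zero _⟩
  have hT : ∀ r, ν.real (Ioi r) = (volume.restrict D).real {z | r < u z} := fun r => by
    rw [hν, map_measureReal_apply hu measurableSet_Ioi]; rfl
  have h := map_measureReal_Ioi ν
  have hm : ν.real univ = (volume D).toReal := by
    rw [hν, map_measureReal_apply hu MeasurableSet.univ]; simp [Measure.real]
  rw [hm, hν, Measure.map_map (continuous_measureReal_Ioi _).measurable hu] at h
  rw [← h]
  congr 1
  funext y
  exact (hT (u y)).symm

lemma measurable_rankOn (hu : Measurable u) : Measurable (rankOn D u) := by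
  have : MeasurableSet {q : ℝ × ℝ | u q.1 < u q.2} := measurableSet_lt (by fun_prop) (by fun_prop)
  exact (measurable_measure_prodMk_left this).ennreal_toReal

/-- For a level `r > g y`, every point of `{g > r}` lies in `D` and strictly precedes `y`, so this
set has measure at most the rank of `y`. -/
lemma decreasingRearrangement_rankOn_le (hDf : volume D ≠ ∞) {g : ℝ → ℝ≥0∞} (hu : Measurable u)
    (hgD : ∀ y ∉ D, g y = 0) (hgu : ∀ y ∈ D, ∀ z ∈ D, g y < g z → u y < u z) {y : ℝ} (hy : y ∈ D)
    (hpos : 0 < rankOn D u y) : decreasingRearrangement g (rankOn D u y) ≤ g y := by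
  have : IsFiniteMeasure (volume.restrict D) := ⟨by simpa using hDf.lt_top⟩
  refine decreasingRearrangement_le (fun r _ hr => ?_) hpos
  by_contra h
  refine absurd hr (not_lt.2 ?_)
  rw [rankOn, ofReal_measureReal,
    Measure.restrict_apply (measurableSet_lt measurable_const hu)]
  refine measure_mono fun z hz => ?_
  have hz' : ENNReal.ofReal r < g z := hz
  have hzD : z ∈ D := by
    by_contra hzD
    rw [hgD z hzD] at hz'
    exact absurd hz' not_lt_zero
  exact ⟨hgu y hy z hzD ((not_le.1 h).trans hz'), hzD⟩

lemma decreasingRearrangement_eq_zero {g : ℝ → ℝ≥0∞} (hgD : ∀ y ∉ D, g y = 0) {t : ℝ}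
    (ht : volume D ≤ ENNReal.ofReal t) : decreasingRearrangement g t = 0 := by
  rcases le_or_gt t 0 with h0 | h0
  · exact decreasingRearrangement_of_nonpos g h0
  · refine le_antisymm (decreasingRearrangement_le (fun r _ hr => absurd
      (hr.trans_le (measure_mono fun z hz => ?_)) (not_lt.2 ht)) h0) zero_le
    by_contra hzD
    have hz' : ENNReal.ofReal r < g z := hz
    rw [hgD z hzD] at hz'
    exact absurd hz' not_lt_zero

/-- Reverse Hardy–Littlewood for aligned functions: `g^*` lives on `[0, |D|]`, and the substitution
`t = rankOn D u y` carries the integral to `D`, where `g^*` at the rank is at most `g`. -/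
lemma lintegral_decreasingRearrangement_mul_le (hD : MeasurableSet D) (hDf : volume D ≠ ∞)
    {g : ℝ → ℝ≥0∞} (hg : Measurable g) (hu : Measurable u)
    (hinj : Function.Injective u) (hgD : ∀ y ∉ D, g y = 0)
    (hgu : ∀ y ∈ D, ∀ z ∈ D, g y < g z → u y < u z) {V : ℝ → ℝ≥0∞} (hV : Measurable V) :
    ∫⁻ t in Ioi (0 : ℝ), decreasingRearrangement g t * V t ≤
      ∫⁻ y in D, g y * V (rankOn D u y) := by
  have hR := measurable_decreasingRearrangement_apply hg
  have hτ := measurable_rankOn (D := D) hu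
  calc ∫⁻ t in Ioi (0 : ℝ), decreasingRearrangement g t * V t
      ≤ ∫⁻ t in Icc 0 (volume D).toReal, decreasingRearrangement g t * V t := by
        rw [← lintegral_indicator measurableSet_Ioi, ← lintegral_indicator measurableSet_Icc]
        refine lintegral_mono fun t => ?_
        by_cases ht : t ∈ Ioi (0 : ℝ)
        · rw [indicator_of_mem ht]
          by_cases h2 : t ∈ Icc 0 (volume D).toReal
          · rw [indicator_of_mem h2]
          · have : volume D ≤ ENNReal.ofReal t := by
              rw [← ENNReal.ofReal_toReal hDf]
              refine ENNReal.ofReal_le_ofReal ?_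
              by_contra h3
              exact h2 ⟨le_of_lt ht, (not_le.1 h3).le⟩
            rw [decreasingRearrangement_eq_zero hgD this]
            simp
        · rw [indicator_of_notMem ht]; exact zero_le
    _ = ∫⁻ y in D, decreasingRearrangement g (rankOn D u y) * V (rankOn D u y) := by
        rw [← map_rankOn hDf hu hinj, lintegral_map (by fun_prop) hτ]
    _ ≤ ∫⁻ y in D, g y * V (rankOn D u y) := by
        refine setLIntegral_mono_ae' hD (ae_of_all _ fun y hy => ?_)
        rcases le_or_gt (rankOn D u y) 0 with h0 | h0
        · rw [decreasingRearrangement_of_nonpos g h0]; simp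
        · gcongr
          exact decreasingRearrangement_rankOn_le hDf hu hgD hgu hy h0

/-- If `V t < r`, monotonicity confines the positive ranks in `{V > r}` to `(0, t]`, and ranks are
distributed by Lebesgue measure. Only an inequality can be expected, as `D` has finite measure. -/
lemma decreasingRearrangement_indicator_rankOn_le (hDf : volume D ≠ ∞)
    (hu : Measurable u) (hinj : Function.Injective u) {V : ℝ → ℝ≥0∞}
    (hV : AntitoneOn V (Ioi 0)) (hVm : Measurable V) {t : ℝ} (ht : 0 < t) :
    decreasingRearrangement (D.indicator fun y => V (rankOn D u y)) t ≤ V t := by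
  refine decreasingRearrangement_le (fun r _ hr => ?_) ht
  by_contra h
  refine absurd hr (not_lt.2 ?_)
  have hτ := measurable_rankOn (D := D) hu
  have hm : MeasurableSet {s | ENNReal.ofReal r < V s} := measurableSet_lt measurable_const hVm
  have h1 : {x | ENNReal.ofReal r < D.indicator (fun y => V (rankOn D u y)) x} =
      rankOn D u ⁻¹' {s | ENNReal.ofReal r < V s} ∩ D := by
    ext x
    by_cases hx : x ∈ D <;> simp [hx]
  rw [h1, ← Measure.restrict_apply (hτ hm), ← Measure.map_apply hτ hm, map_rankOn hDf hu hinj,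
    Measure.restrict_apply hm]
  calc _ ≤ volume (Icc 0 t) := measure_mono fun s hs => ⟨hs.2.1, ?_⟩
    _ = ENNReal.ofReal t := by rw [Real.volume_Icc, sub_zero]
  by_contra hst
  have hst := not_le.1 hst
  exact h ((le_of_lt hs.1).trans (hV ht (ht.trans hst) hst.le))

end Rank

/-! ### The profile `V(2|y|)` on the whole line. -/

lemma volume_two_mul_abs_le (t : ℝ) :
    volume {y : ℝ | 2 * |y| ≤ t} = ENNReal.ofReal t := by
  have : {y : ℝ | 2 * |y| ≤ t} = Icc (-(t / 2)) (t / 2) := by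
    ext y
    rw [mem_Icc, ← abs_le]
    constructor
    · intro h; change 2 * |y| ≤ t at h; linarith
    · intro h; change 2 * |y| ≤ t; linarith
  rw [this, Real.volume_Icc]
  congr 1; ring

lemma decreasingRearrangement_comp_abs_le {V : ℝ → ℝ≥0∞} (hV : AntitoneOn V (Ioi 0))
    {t : ℝ} (ht : 0 < t) : decreasingRearrangement (fun y => V (2 * |y|)) t ≤ V t := by
  refine decreasingRearrangement_le (fun r _ hr => ?_) ht
  by_contra h
  refine absurd hr (not_lt.2 ?_)
  rw [← volume_two_mul_abs_le t]
  refine measure_mono fun y hy => ?_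
  have hy' : ENNReal.ofReal r < V (2 * |y|) := hy
  show 2 * |y| ≤ t
  by_contra hst
  have hst := not_le.1 hst
  exact h (hy'.le.trans (hV ht (ht.trans hst) hst.le))

lemma le_decreasingRearrangement_comp_abs {V : ℝ → ℝ≥0∞} (hV : AntitoneOn V (Ioi 0))
    {s t : ℝ} (ht : 0 < t) (hst : t < s) :
    V s ≤ decreasingRearrangement (fun y => V (2 * |y|)) t := by
  refine le_of_forall_lt_imp_le_of_dense fun c hc => ?_
  have hc_top : c ≠ ∞ := hc.ne_top
  rw [← ENNReal.ofReal_toReal hc_top] at hc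
  rw [← ENNReal.ofReal_toReal hc_top]
  refine le_decreasingRearrangement ht ?_
  calc ENNReal.ofReal t < ENNReal.ofReal s := (ENNReal.ofReal_lt_ofReal_iff (ht.trans hst)).2 hst
    _ = volume {y : ℝ | 2 * |y| ≤ s} := (volume_two_mul_abs_le s).symm
    -- The origin is discarded because `V 0` is not controlled by monotonicity on `(0, ∞)`.
    _ = volume ({y : ℝ | 2 * |y| ≤ s} \ {0}) := (measure_sdiff_null (by simp)).symm
    _ ≤ _ := measure_mono fun y hy => hc.trans_le
      (hV (show 0 < 2 * |y| from by simpa using hy.2) (ht.trans hst) hy.1)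

/-- The rearrangement at `t` lies between the right limit of `V` at `t` and `V t`; these differ only
at the countably many discontinuities of a monotone function. -/
lemma decreasingRearrangement_comp_abs_ae {V : ℝ → ℝ≥0∞} (hV : AntitoneOn V (Ioi 0)) :
    ∀ᵐ t : ℝ, 0 < t → decreasingRearrangement (fun y => V (2 * |y|)) t = V t := by
  have hc := hV.countable_not_continuousWithinAt.measure_zero volume
  filter_upwards [measure_eq_zero_iff_ae_notMem.1 hc] with t ht h0
  have hcont : ContinuousWithinAt V (Ioi 0) t := by
    by_contra h; exact ht ⟨h0, h⟩
  have hcont : Filter.Tendsto V (nhdsWithin t (Ioi t)) (nhds (V t)) :=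
    (hcont.mono (Ioi_subset_Ioi (le_of_lt h0)))
  refine le_antisymm (decreasingRearrangement_comp_abs_le hV h0) (le_of_tendsto hcont ?_)
  filter_upwards [self_mem_nhdsWithin] with s hs
  exact le_decreasingRearrangement_comp_abs hV h0 hs

/-! ### Reduction to lines and the upper bound. -/

/-- The weight does not involve `s`, so integrating in `s` first undoes the rearrangement in `x`. -/
lemma lintegral_quadrant_decreasingRearrangement {G : ℝ × ℝ → ℝ≥0∞} (hG : Measurable G)
    {W : ℝ → ℝ≥0∞} (hW : Measurable W) :
    ∫⁻ p in Ioi (0 : ℝ) ×ˢ Ioi (0 : ℝ),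
      decreasingRearrangement (fun x => decreasingRearrangement (fun y => G (x, y)) p.2) p.1 * W p.2
      = ∫⁻ x, ∫⁻ t in Ioi (0 : ℝ), decreasingRearrangement (fun y => G (x, y)) t * W t := by
  have h1 := measurable_decreasingRearrangement hG
  have h2 : Measurable fun q : ℝ × ℝ => decreasingRearrangement
      (fun x => decreasingRearrangement (fun y => G (x, y)) q.1) q.2 :=
    measurable_decreasingRearrangement
      (G := fun q : ℝ × ℝ => decreasingRearrangement (fun y => G (q.2, y)) q.1)
      (h1.comp measurable_swap)
  have h3 : Measurable fun p : ℝ × ℝ => decreasingRearrangement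
      (fun x => decreasingRearrangement (fun y => G (x, y)) p.2) p.1 * W p.2 :=
    (h2.comp measurable_swap).mul (hW.comp measurable_snd)
  rw [Measure.volume_eq_prod, ← Measure.prod_restrict, lintegral_prod_symm' _ h3]
  calc _ = ∫⁻ t in Ioi (0 : ℝ), ∫⁻ x, decreasingRearrangement (fun y => G (x, y)) t * W t := by
        refine lintegral_congr fun t => ?_
        have h4 : Measurable fun x => decreasingRearrangement (fun y => G (x, y)) t :=
          h1.comp (by fun_prop : Measurable fun x : ℝ => (x, t))
        simp only
        rw [lintegral_mul_const _ (measurable_decreasingRearrangement_apply h4),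
          lintegral_mul_const _ h4, lintegral_decreasingRearrangement h4]
    _ = _ := by
        refine lintegral_lintegral_swap (Measurable.aemeasurable ?_)
        exact (h1.comp measurable_swap).mul (hW.comp measurable_fst)

/-- If `{g > q}` had positive measure for some rational `q > c`, then `g^* ≥ q > c` on the nonempty
interval `(0, |{g > q}|)`. -/
lemma ae_le_of_decreasingRearrangement_ae_eq {g : ℝ → ℝ≥0∞} {c : ℝ≥0∞}
    (h : ∀ᵐ s ∂(volume.restrict (Ioi (0 : ℝ))), decreasingRearrangement g s = c) :
    ∀ᵐ x, g x ≤ c := by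
  have key : ∀ q : ℚ, c < ENNReal.ofReal q → ∀ᵐ x, ¬ ENNReal.ofReal q < g x := by
    intro q hq
    by_contra hne
    have hne : volume {x | ENNReal.ofReal (q : ℝ) < g x} ≠ 0 := by
      rw [← frequently_ae_iff]; exact hne
    have hm : MeasurableSet
        {s : ℝ | ENNReal.ofReal s < volume {x | ENNReal.ofReal (q : ℝ) < g x}} :=
      measurableSet_lt ENNReal.measurable_ofReal measurable_const
    have h2 : ∃ᵐ s ∂(volume.restrict (Ioi (0 : ℝ))),
        ENNReal.ofReal s < volume {x | ENNReal.ofReal (q : ℝ) < g x} := by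
      rw [frequently_ae_iff, ← one_mul (Measure.restrict _ _ _), ← lintegral_indicator_const hm 1,
        lintegral_indicator_ofReal_lt]
      exact hne
    obtain ⟨s, hs, hsc, hs0⟩ :=
      (h2.and_eventually (h.and (ae_restrict_mem measurableSet_Ioi))).exists
    have := le_decreasingRearrangement hs0 hs
    rw [hsc] at this
    exact absurd hq (not_lt.2 this)
  have h3 : ∀ᵐ x, ∀ q : ℚ, c < ENNReal.ofReal q → ¬ ENNReal.ofReal q < g x := by
    rw [ae_all_iff]
    intro q
    by_cases hq : c < ENNReal.ofReal q
    · filter_upwards [key q hq] with x hx _ using hx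
    · exact ae_of_all _ fun x h => absurd h hq
  filter_upwards [h3] with x hx
  by_contra hlt
  obtain ⟨q, _, h1, h2⟩ := ENNReal.lt_iff_exists_rat_btwn.1 (not_le.1 hlt)
  exact hx q h1 h2

lemma ae_ae_swap_of_ae_quadrant {P : ℝ → ℝ → Prop}
    (h : ∀ᵐ p ∂((volume : Measure (ℝ × ℝ)).restrict (Ioi 0 ×ˢ Ioi 0)), P p.1 p.2) :
    ∀ᵐ t ∂(volume.restrict (Ioi (0 : ℝ))), ∀ᵐ s ∂(volume.restrict (Ioi (0 : ℝ))), P s t := by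
  rw [Measure.volume_eq_prod, ← Measure.prod_restrict] at h
  have h2 := (Measure.measurePreserving_swap (μ := volume.restrict (Ioi (0 : ℝ)))
    (ν := volume.restrict (Ioi (0 : ℝ)))).quasiMeasurePreserving.ae h
  exact Measure.ae_ae_of_ae_prod h2

lemma lintegral_mul_le_of_ae_quadrant {G H : ℝ × ℝ → ℝ≥0∞} (hG : Measurable G) (hH : Measurable H)
    {W : ℝ → ℝ≥0∞} (hW : Measurable W)
    (h : ∀ᵐ p ∂((volume : Measure (ℝ × ℝ)).restrict (Ioi 0 ×ˢ Ioi 0)),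
      decreasingRearrangement (fun x => decreasingRearrangement (fun y => H (x, y)) p.2) p.1
        = W p.2) :
    ∫⁻ p, G p * H p ≤
      ∫⁻ x, ∫⁻ t in Ioi (0 : ℝ), decreasingRearrangement (fun y => G (x, y)) t * W t := by
  have h1 := measurable_decreasingRearrangement hG
  have h2 := measurable_decreasingRearrangement hH
  have hle : ∀ᵐ t ∂(volume.restrict (Ioi (0 : ℝ))), ∀ᵐ x,
      decreasingRearrangement (fun y => H (x, y)) t ≤ W t := by
    filter_upwards [ae_ae_swap_of_ae_quadrant
      (P := fun s t => decreasingRearrangement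
        (fun x => decreasingRearrangement (fun y => H (x, y)) t) s = W t) h] with t ht
    exact ae_le_of_decreasingRearrangement_ae_eq ht
  have m1 : Measurable fun q : ℝ × ℝ => decreasingRearrangement (fun y => G (q.1, y)) q.2 *
      decreasingRearrangement (fun y => H (q.1, y)) q.2 := h1.mul h2
  have m2 : Measurable fun q : ℝ × ℝ =>
      decreasingRearrangement (fun y => G (q.1, y)) q.2 * W q.2 := h1.mul (hW.comp measurable_snd)
  calc ∫⁻ p, G p * H p = ∫⁻ x, ∫⁻ y, G (x, y) * H (x, y) := by
        rw [Measure.volume_eq_prod, lintegral_prod _ (by fun_prop)]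
    _ ≤ ∫⁻ x, ∫⁻ t in Ioi (0 : ℝ), decreasingRearrangement (fun y => G (x, y)) t *
          decreasingRearrangement (fun y => H (x, y)) t :=
        lintegral_mono fun x => lintegral_mul_le_decreasingRearrangement (by fun_prop) (by fun_prop)
    _ = ∫⁻ t in Ioi (0 : ℝ), ∫⁻ x, decreasingRearrangement (fun y => G (x, y)) t *
          decreasingRearrangement (fun y => H (x, y)) t := lintegral_lintegral_swap m1.aemeasurable
    _ ≤ ∫⁻ t in Ioi (0 : ℝ), ∫⁻ x, decreasingRearrangement (fun y => G (x, y)) t * W t := by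
        refine lintegral_mono_ae ?_
        filter_upwards [hle] with t ht
        refine lintegral_mono_ae ?_
        filter_upwards [ht] with x hx
        gcongr
    _ = _ := (lintegral_lintegral_swap m2.aemeasurable).symm

/-- Levels below `c` are exceeded on a set of infinite measure, so the values of `φ` on `[-N, N]`
are invisible to the rearrangement. This is the freedom used to build extremal functions. -/
lemma decreasingRearrangement_eq_of_eq_far {φ : ℝ → ℝ≥0∞} {c : ℝ≥0∞} {N s : ℝ} (hs : 0 < s)
    (hle : ∀ x, φ x ≤ c) (heq : ∀ x, N < |x| → φ x = c) : decreasingRearrangement φ s = c := by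
  refine le_antisymm (decreasingRearrangement_le (fun r _ hr => ?_) hs) ?_
  · obtain ⟨x, hx⟩ := nonempty_of_measure_ne_zero (ne_zero_of_lt hr)
    exact (le_of_lt hx).trans (hle x)
  · refine le_of_forall_lt_imp_le_of_dense fun d hd => ?_
    have hd_top : d ≠ ∞ := hd.ne_top
    rw [← ENNReal.ofReal_toReal hd_top] at hd
    rw [← ENNReal.ofReal_toReal hd_top]
    refine le_decreasingRearrangement hs ?_
    have : volume {x | ENNReal.ofReal d.toReal < φ x} = ∞ := by
      refine eq_top_mono (measure_mono (s := Ioi N) fun x hx => ?_) (Real.volume_Ioi)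
      show ENNReal.ofReal d.toReal < φ x
      rw [heq x (lt_of_lt_of_le hx (le_abs_self x))]
      exact hd
    rw [this]
    exact ENNReal.ofReal_lt_top

/-! ### Dyadic truncation and the nearly extremal functions. -/

section Approximation

/-- Dyadic approximation from below of `|a|`. -/
noncomputable def dyadicFloor (n : ℕ) (a : ℝ) : ℕ := ⌊|a| * 2 ^ n⌋₊

lemma measurable_dyadicFloor (n : ℕ) : Measurable (dyadicFloor n) :=
  Nat.measurable_floor.comp (by fun_prop)

lemma monotone_dyadicFloor_div (a : ℝ) : Monotone fun n => (dyadicFloor n a : ℝ) / 2 ^ n := by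
  refine monotone_nat_of_le_succ fun n => ?_
  have h : 2 * dyadicFloor n a ≤ dyadicFloor (n + 1) a := by
    refine Nat.le_floor ?_
    have := Nat.floor_le (show 0 ≤ |a| * 2 ^ n by positivity)
    rw [dyadicFloor]
    push_cast
    rw [pow_succ]
    linarith
  rw [div_le_div_iff₀ (by positivity) (by positivity), pow_succ]
  have h' : (2 : ℝ) * dyadicFloor n a ≤ dyadicFloor (n + 1) a := by exact_mod_cast h
  nlinarith [show (0 : ℝ) < 2 ^ n by positivity]

lemma tendsto_dyadicFloor_div (a : ℝ) :
    Filter.Tendsto (fun n => (dyadicFloor n a : ℝ) / 2 ^ n) Filter.atTop (nhds |a|) :=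
  (tendsto_nat_floor_mul_div_atTop (abs_nonneg a)).comp
    (tendsto_pow_atTop_atTop_of_one_lt (one_lt_two : (1 : ℝ) < 2))

/-- The square of side `2n` around the origin. -/
def centeredSquare (n : ℕ) : Set (ℝ × ℝ) := {p | |p.1| ≤ n ∧ |p.2| ≤ n}

lemma measurableSet_centeredSquare (n : ℕ) : MeasurableSet (centeredSquare n) :=
  (measurableSet_le (f := fun p : ℝ × ℝ => |p.1|) (by fun_prop) measurable_const).inter
    (measurableSet_le (f := fun p : ℝ × ℝ => |p.2|) (by fun_prop) measurable_const)

/-- Approximation of `|f|` from below by a bounded, dyadic valued function of bounded support. -/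
noncomputable def dyadicApprox (f : ℝ × ℝ → ℝ) (n : ℕ) : ℝ × ℝ → ℝ≥0∞ :=
  (centeredSquare n).indicator fun p => ENNReal.ofReal (dyadicFloor n (f p) / 2 ^ n)

lemma measurable_dyadicApprox {f : ℝ × ℝ → ℝ} (hf : Measurable f) (n : ℕ) :
    Measurable (dyadicApprox f n) := by
  have : Measurable fun p => (dyadicFloor n (f p) : ℝ) :=
    measurable_from_nat.comp ((measurable_dyadicFloor n).comp hf)
  exact Measurable.indicator (by fun_prop) (measurableSet_centeredSquare n)

lemma monotone_dyadicApprox (f : ℝ × ℝ → ℝ) : Monotone (dyadicApprox f) := by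
  intro m n hmn p
  have hcast : (m : ℝ) ≤ n := by exact_mod_cast hmn
  have hsub : centeredSquare m ⊆ centeredSquare n := fun q hq =>
    ⟨hq.1.trans hcast, hq.2.trans hcast⟩
  refine (indicator_le_indicator_of_subset hsub (fun _ => zero_le) p).trans ?_
  exact indicator_le_indicator
    (ENNReal.ofReal_le_ofReal (monotone_dyadicFloor_div (f p) hmn))

lemma iSup_dyadicApprox (f : ℝ × ℝ → ℝ) (p : ℝ × ℝ) : ⨆ n, dyadicApprox f n p = ‖f p‖ₑ := by
  refine iSup_eq_of_tendsto (fun m n hmn => monotone_dyadicApprox f hmn p) ?_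
  rw [Real.enorm_eq_ofReal_abs]
  refine (ENNReal.tendsto_ofReal (tendsto_dyadicFloor_div (f p))).congr' ?_
  obtain ⟨k, hk⟩ := exists_nat_ge (max |p.1| |p.2|)
  filter_upwards [Filter.eventually_ge_atTop k] with n hn
  have hcast : (k : ℝ) ≤ n := by exact_mod_cast hn
  have : p ∈ centeredSquare n :=
    ⟨(le_max_left _ _).trans (hk.trans hcast), (le_max_right _ _).trans (hk.trans hcast)⟩
  simp [dyadicApprox, this]

/-- An injective refinement, in the second variable, of the order given by the dyadic
approximation of `|f|`. -/
noncomputable def tieBreak (f : ℝ × ℝ → ℝ) (n : ℕ) (p : ℝ × ℝ) : ℝ :=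
  dyadicFloor n (f p) + Real.sigmoid p.2

lemma measurable_tieBreak {f : ℝ × ℝ → ℝ} (hf : Measurable f) (n : ℕ) :
    Measurable (tieBreak f n) := by
  have h1 : Measurable fun p => (dyadicFloor n (f p) : ℝ) :=
    measurable_from_nat.comp ((measurable_dyadicFloor n).comp hf)
  exact h1.add (continuous_sigmoid.measurable.comp measurable_snd)

/-- The sigmoid term lies in `(0, 1)` and cannot undo a gap of at least one between integer levels;
being strictly increasing in `y`, it separates points of equal level. -/
lemma tieBreak_lt_of_dyadicFloor_lt (f : ℝ × ℝ → ℝ) (n : ℕ) {p q : ℝ × ℝ}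
    (h : dyadicFloor n (f p) < dyadicFloor n (f q)) : tieBreak f n p < tieBreak f n q := by
  have h' : (dyadicFloor n (f p) : ℝ) + 1 ≤ dyadicFloor n (f q) := by exact_mod_cast h
  unfold tieBreak
  linarith [Real.sigmoid_lt_one p.2, Real.sigmoid_pos q.2]

lemma injective_tieBreak (f : ℝ × ℝ → ℝ) (n : ℕ) (x : ℝ) :
    Function.Injective fun y => tieBreak f n (x, y) := by
  intro y z h
  have hK : dyadicFloor n (f (x, y)) = dyadicFloor n (f (x, z)) := by
    rcases lt_trichotomy (dyadicFloor n (f (x, y))) (dyadicFloor n (f (x, z))) with h1 | h1 | h1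
    · exact absurd h (tieBreak_lt_of_dyadicFloor_lt f n h1).ne
    · exact h1
    · exact absurd h (tieBreak_lt_of_dyadicFloor_lt f n h1).ne'
  simpa [tieBreak, hK, Real.sigmoid_inj] using h

lemma tieBreak_lt_of_dyadicApprox_lt (f : ℝ × ℝ → ℝ) (n : ℕ) {p q : ℝ × ℝ}
    (hp : p ∈ centeredSquare n) (hq : q ∈ centeredSquare n)
    (h : dyadicApprox f n p < dyadicApprox f n q) : tieBreak f n p < tieBreak f n q := by
  refine tieBreak_lt_of_dyadicFloor_lt f n ?_
  by_contra hle
  refine absurd h (not_lt.2 ?_)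
  rw [dyadicApprox, indicator_of_mem hp, indicator_of_mem hq]
  have : (dyadicFloor n (f q) : ℝ) ≤ dyadicFloor n (f p) := by exact_mod_cast not_lt.1 hle
  gcongr

lemma measurable_rankOn_prod (D : Set ℝ) {u : ℝ × ℝ → ℝ} (hu : Measurable u) :
    Measurable fun p : ℝ × ℝ => rankOn D (fun y => u (p.1, y)) p.2 := by
  have : MeasurableSet {q : (ℝ × ℝ) × ℝ | u (q.1.1, q.1.2) < u (q.1.1, q.2)} :=
    measurableSet_lt (by fun_prop) (by fun_prop)
  exact (measurable_measure_prodMk_left (ν := volume.restrict D) this).ennreal_toReal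

/-- A function whose two-dimensional rearrangement is `w`, and which for `|x| ≤ n` is arranged,
as a function of `y`, in the same order as the dyadic approximation of `|f|`. -/
noncomputable def alignedFunction (f : ℝ × ℝ → ℝ) (w : ℝ → ℝ) (n : ℕ) (p : ℝ × ℝ) : ℝ :=
  if |p.1| ≤ n then
    if |p.2| ≤ n then w (rankOn {y | |y| ≤ n} (fun y => tieBreak f n (p.1, y)) p.2) else 0
  else w (2 * |p.2|)

variable {f : ℝ × ℝ → ℝ} {w : ℝ → ℝ}

lemma measurable_alignedFunction (hf : Measurable f) (hw : Measurable w) (n : ℕ) :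
    Measurable (alignedFunction f w n) := by
  have h1 := measurable_rankOn_prod {y | |y| ≤ n} (measurable_tieBreak hf n)
  refine Measurable.ite (measurableSet_le (by fun_prop) (by fun_prop)) ?_ (by fun_prop)
  exact Measurable.ite (measurableSet_le (by fun_prop) (by fun_prop)) (hw.comp h1) (by fun_prop)

lemma alignedFunction_nonneg (hw : ∀ t, 0 ≤ w t) (n : ℕ) (p : ℝ × ℝ) :
    0 ≤ alignedFunction f w n p := by
  unfold alignedFunction
  split_ifs
  · exact hw _
  · exact le_rfl
  · exact hw _

lemma ofReal_alignedFunction_of_le {n : ℕ} {x : ℝ} (hx : |x| ≤ n) :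
    (fun y => ENNReal.ofReal (alignedFunction f w n (x, y))) = {y : ℝ | |y| ≤ n}.indicator
      fun y => ENNReal.ofReal (w (rankOn {y | |y| ≤ n} (fun y => tieBreak f n (x, y)) y)) := by
  funext y
  by_cases hy : |y| ≤ n <;> simp [alignedFunction, hx, hy, indicator]

lemma ofReal_alignedFunction_of_lt {n : ℕ} {x : ℝ} (hx : (n : ℝ) < |x|) :
    (fun y => ENNReal.ofReal (alignedFunction f w n (x, y))) =
      fun y => ENNReal.ofReal (w (2 * |y|)) := by
  funext y
  simp [alignedFunction, hx.not_ge]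

lemma volume_abs_le_ne_top (n : ℕ) : volume {y : ℝ | |y| ≤ n} ≠ ∞ := by
  have : {y : ℝ | |y| ≤ n} = Icc (-(n : ℝ)) n := by ext y; exact abs_le (a := y)
  rw [this, Real.volume_Icc]
  exact ENNReal.ofReal_ne_top

lemma measurableSet_abs_le (n : ℕ) : MeasurableSet {y : ℝ | |y| ≤ n} :=
  measurableSet_le (by fun_prop) (by fun_prop)

lemma rearrangement_alignedFunction (hf : Measurable f) (hw : Measurable w)
    (hanti : AntitoneOn w (Ioi 0)) (n : ℕ) :
    ∀ᵐ t : ℝ, 0 < t → ∀ s > 0, decreasingRearrangement (fun x => decreasingRearrangement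
      (fun y => ENNReal.ofReal (alignedFunction f w n (x, y))) t) s = ENNReal.ofReal (w t) := by
  have hV : AntitoneOn (fun t => ENNReal.ofReal (w t)) (Ioi 0) := fun a ha b hb hab =>
    ENNReal.ofReal_le_ofReal (hanti ha hb hab)
  filter_upwards [decreasingRearrangement_comp_abs_ae hV] with t ht h0 s hs
  have hfar : ∀ x, (n : ℝ) < |x| → decreasingRearrangement
      (fun y => ENNReal.ofReal (alignedFunction f w n (x, y))) t = ENNReal.ofReal (w t) := by
    intro x hx
    rw [ofReal_alignedFunction_of_lt hx]
    exact ht h0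
  refine decreasingRearrangement_eq_of_eq_far hs (fun x => ?_) hfar
  rcases le_or_gt |x| n with hx | hx
  · rw [ofReal_alignedFunction_of_le hx]
    have hu : Measurable fun y => tieBreak f n (x, y) :=
      (measurable_tieBreak hf n).comp (by fun_prop)
    exact decreasingRearrangement_indicator_rankOn_le (volume_abs_le_ne_top n) hu
      (injective_tieBreak f n x) hV (by fun_prop) h0
  · exact (hfar x hx).le

/-- Columns with `|x| ≤ n` are aligned, so the reverse Hardy–Littlewood inequality applies there; on
the others the truncation vanishes. -/
lemma lintegral_dyadicApprox_le (hf : Measurable f) (hw : Measurable w) (n : ℕ) :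
    ∫⁻ x, ∫⁻ t in Ioi (0 : ℝ), decreasingRearrangement (fun y => dyadicApprox f n (x, y)) t *
      ENNReal.ofReal (w t) ≤ ∫⁻ p, ‖f p‖ₑ * ENNReal.ofReal (alignedFunction f w n p) := by
  have hA := measurable_alignedFunction hf hw n
  have hle : ∀ p, dyadicApprox f n p ≤ ‖f p‖ₑ := fun p => by
    rw [← iSup_dyadicApprox f p]
    exact le_iSup (fun n => dyadicApprox f n p) n
  rw [Measure.volume_eq_prod, lintegral_prod _ (by fun_prop)]
  refine lintegral_mono fun x => ?_
  rcases le_or_gt |x| n with hx | hx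
  · have hu : Measurable fun y => tieBreak f n (x, y) :=
      (measurable_tieBreak hf n).comp (by fun_prop)
    have hg : Measurable fun y => dyadicApprox f n (x, y) :=
      (measurable_dyadicApprox hf n).comp (by fun_prop)
    refine (lintegral_decreasingRearrangement_mul_le (measurableSet_abs_le n)
      (volume_abs_le_ne_top n) hg hu (injective_tieBreak f n x) (fun y hy => ?_)
      (fun y hy z hz hlt => tieBreak_lt_of_dyadicApprox_lt f n ⟨hx, hy⟩ ⟨hx, hz⟩ hlt)
      (V := fun t => ENNReal.ofReal (w t)) (by fun_prop)).trans ?_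
    · exact indicator_of_notMem (fun h => hy h.2) _
    · rw [← lintegral_indicator (measurableSet_abs_le n)]
      refine lintegral_mono fun y => ?_
      have := congrFun (ofReal_alignedFunction_of_le (f := f) (w := w) hx) y
      simp only [this]
      by_cases hy : y ∈ {y : ℝ | |y| ≤ n}
      · rw [indicator_of_mem hy, indicator_of_mem hy]
        gcongr
        exact hle _
      · rw [indicator_of_notMem hy]
        exact zero_le
  · have : ∀ t, decreasingRearrangement (fun y => dyadicApprox f n (x, y)) t = 0 := by
      intro t
      refine decreasingRearrangement_eq_zero (D := ∅) (fun y _ => ?_) (by simp)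
      exact indicator_of_notMem (fun h => hx.not_ge h.1) _
    simp [this]

end Approximation

/-! ### Null sets, extension of `v`, and monotone limits. -/

lemma rearrangement₂_congr {f f' : ℝ × ℝ → ℝ} (h : f =ᵐ[volume] f') :
    rearrangement₂ f = rearrangement₂ f' := by
  rw [Measure.volume_eq_prod] at h
  funext s t
  refine decreasingRearrangement_congr ?_ s
  filter_upwards [Measure.ae_ae_of_ae_prod h] with x hx
  refine decreasingRearrangement_congr ?_ t
  filter_upwards [hx] with y hy
  rw [hy]

/-- The extension of `v` from `(0, ∞)` to the real line by zero. -/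
noncomputable def zeroExtension (v : ℝ → ℝ) (t : ℝ) : ℝ := if 0 < t then v t else 0

lemma zeroExtension_of_pos (v : ℝ → ℝ) {t : ℝ} (ht : 0 < t) : zeroExtension v t = v t :=
  if_pos ht

lemma zeroExtension_nonneg {v : ℝ → ℝ} (hv0 : ∀ t ∈ Ioi (0 : ℝ), 0 ≤ v t) (t : ℝ) :
    0 ≤ zeroExtension v t := by
  unfold zeroExtension
  split_ifs with h
  · exact hv0 t h
  · exact le_rfl

lemma antitoneOn_zeroExtension {v : ℝ → ℝ} (hv : AntitoneOn v (Ioi 0)) :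
    AntitoneOn (zeroExtension v) (Ioi 0) := fun a ha b hb hab => by
  rw [zeroExtension_of_pos v ha, zeroExtension_of_pos v hb]
  exact hv ha hb hab

lemma measurable_zeroExtension {v : ℝ → ℝ} (hv : AntitoneOn v (Ioi 0))
    (hv0 : ∀ t ∈ Ioi (0 : ℝ), 0 ≤ v t) : Measurable (zeroExtension v) := by
  -- The value `∞` on `t ≤ 0` makes the function decreasing on the whole line, hence measurable;
  -- `toReal` then turns `∞` into the required `0`.
  have hanti : Antitone fun t : ℝ => if 0 < t then ENNReal.ofReal (v t) else ∞ := by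
    intro a b hab
    by_cases ha : 0 < a
    · simp only [ha, ha.trans_le hab, if_true]
      exact ENNReal.ofReal_le_ofReal (hv ha (ha.trans_le hab) hab)
    · simp only [ha, if_false, le_top]
  have : zeroExtension v =
      fun t => (if 0 < t then ENNReal.ofReal (v t) else ∞ : ℝ≥0∞).toReal := by
    funext t
    by_cases ht : 0 < t
    · simp [zeroExtension, ht, hv0 t ht]
    · simp [zeroExtension, ht]
  rw [this]
  exact hanti.measurable.ennreal_toReal

lemma lintegral_rearrangement₂_mul {f : ℝ × ℝ → ℝ} (hf : Measurable f) {v : ℝ → ℝ}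
    (hw : Measurable (zeroExtension v)) :
    ∫⁻ p in Ioi (0 : ℝ) ×ˢ Ioi (0 : ℝ), rearrangement₂ f p.1 p.2 * ENNReal.ofReal (v p.2) =
      ∫⁻ x, ∫⁻ t in Ioi (0 : ℝ), decreasingRearrangement (fun y => ‖f (x, y)‖ₑ) t *
        ENNReal.ofReal (zeroExtension v t) := by
  rw [← lintegral_quadrant_decreasingRearrangement (G := fun p => ‖f p‖ₑ) (by fun_prop)
    (W := fun t => ENNReal.ofReal (zeroExtension v t)) (by fun_prop)]
  refine setLIntegral_congr_fun (measurableSet_Ioi.prod measurableSet_Ioi) fun p hp => ?_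
  simp only [rearrangement₂, zeroExtension_of_pos v hp.2]

lemma iSup_lintegral_lintegral {X Y : Type*} [MeasurableSpace X] [MeasurableSpace Y]
    {μ : Measure X} {ν : Measure Y} [SFinite ν] {F : ℕ → X × Y → ℝ≥0∞}
    (hF : ∀ n, Measurable (F n)) (hmono : Monotone F) :
    ⨆ n, ∫⁻ x, ∫⁻ y, F n (x, y) ∂ν ∂μ = ∫⁻ x, ∫⁻ y, ⨆ n, F n (x, y) ∂ν ∂μ := by
  have h1 : ∀ n, Measurable fun x => ∫⁻ y, F n (x, y) ∂ν := fun n => (hF n).lintegral_prod_right'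
  rw [← lintegral_iSup h1 fun m n hmn x => lintegral_mono fun y => hmono hmn (x, y)]
  refine lintegral_congr fun x => ?_
  have h2 : ∀ n, Measurable fun y => F n (x, y) := fun n => (hF n).comp measurable_prodMk_left
  rw [← lintegral_iSup h2 fun m n hmn y => hmono hmn (x, y)]

lemma iSup_lintegral_dyadicApprox {f : ℝ × ℝ → ℝ} (hf : Measurable f) {W : ℝ → ℝ≥0∞}
    (hW : Measurable W) :
    ⨆ n, ∫⁻ x, ∫⁻ t in Ioi (0 : ℝ),
        decreasingRearrangement (fun y => dyadicApprox f n (x, y)) t * W t =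
      ∫⁻ x, ∫⁻ t in Ioi (0 : ℝ), decreasingRearrangement (fun y => ‖f (x, y)‖ₑ) t * W t := by
  have hm : ∀ n, Measurable fun q : ℝ × ℝ =>
      decreasingRearrangement (fun y => dyadicApprox f n (q.1, y)) q.2 * W q.2 := fun n =>
    (measurable_decreasingRearrangement (measurable_dyadicApprox hf n)).mul
      (hW.comp measurable_snd)
  have hmono : ∀ x, Monotone fun n y => dyadicApprox f n (x, y) := fun x m n hmn y =>
    monotone_dyadicApprox f hmn (x, y)
  have hmono' : Monotone fun n (q : ℝ × ℝ) =>
      decreasingRearrangement (fun y => dyadicApprox f n (q.1, y)) q.2 * W q.2 :=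
    fun m n hmn q => mul_le_mul' (decreasingRearrangement_mono (hmono q.1 hmn) q.2) le_rfl
  refine (iSup_lintegral_lintegral (μ := volume) (ν := volume.restrict (Ioi 0)) hm hmono').trans ?_
  refine lintegral_congr fun x => lintegral_congr fun t => ?_
  have h := decreasingRearrangement_iSup (hmono x) t
  simp only [iSup_dyadicApprox] at h
  rw [h, ENNReal.iSup_mul]

/-! ### The two bounds and the conclusion. -/

lemma lintegral_enorm_mul_le {f h : ℝ × ℝ → ℝ} (hf : AEMeasurable f volume) {v : ℝ → ℝ}
    (hv : AntitoneOn v (Ioi 0)) (hv0 : ∀ t ∈ Ioi (0 : ℝ), 0 ≤ v t) (hh : HasRearrangement₂ h v) :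
    ∫⁻ p, ‖f p * h p‖ₑ ≤
      ∫⁻ p in Ioi (0 : ℝ) ×ˢ Ioi (0 : ℝ), rearrangement₂ f p.1 p.2 * ENNReal.ofReal (v p.2) := by
  obtain ⟨hhm, hhv⟩ := hh
  have hw := measurable_zeroExtension hv hv0
  rw [rearrangement₂_congr hf.ae_eq_mk, lintegral_rearrangement₂_mul hf.measurable_mk hw]
  have e : ∫⁻ p, ‖f p * h p‖ₑ = ∫⁻ p, ‖hf.mk f p‖ₑ * ‖hhm.mk h p‖ₑ := by
    refine lintegral_congr_ae ?_
    filter_upwards [hf.ae_eq_mk, hhm.ae_eq_mk] with p h1 h2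
    rw [← h1, ← h2, enorm_mul]
  rw [e]
  refine lintegral_mul_le_of_ae_quadrant (G := fun p => ‖hf.mk f p‖ₑ)
    (H := fun p => ‖hhm.mk h p‖ₑ) hf.measurable_mk.enorm hhm.measurable_mk.enorm
    (by fun_prop) ?_
  rw [rearrangement₂_congr hhm.ae_eq_mk] at hhv
  filter_upwards [hhv, ae_restrict_mem (measurableSet_Ioi.prod measurableSet_Ioi)] with p h1 h2
  rw [zeroExtension_of_pos v h2.2, ← h1]
  rfl

lemma exists_hasRearrangement₂ {f : ℝ × ℝ → ℝ} (hf : AEMeasurable f volume) {v : ℝ → ℝ}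
    (hv : AntitoneOn v (Ioi 0)) (hv0 : ∀ t ∈ Ioi (0 : ℝ), 0 ≤ v t) (n : ℕ) :
    ∃ h : ℝ × ℝ → ℝ, HasRearrangement₂ h v ∧ (∀ p, 0 ≤ f p * h p) ∧
      ∫⁻ x, ∫⁻ t in Ioi (0 : ℝ),
        decreasingRearrangement (fun y => dyadicApprox (hf.mk f) n (x, y)) t *
          ENNReal.ofReal (zeroExtension v t) ≤ ∫⁻ p, ‖f p * h p‖ₑ := by
  have hw := measurable_zeroExtension hv hv0
  have hmk := hf.measurable_mk
  set H := alignedFunction (hf.mk f) (zeroExtension v) n with hH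
  have hHm : Measurable H := measurable_alignedFunction hmk hw n
  have hH0 : ∀ p, 0 ≤ H p := alignedFunction_nonneg (zeroExtension_nonneg hv0) n
  -- A sign with `σ 0 = 1`: then `|σ(f) H| = H` also on the zeros of `f`, and the rearrangement is
  -- unaffected.
  set σ : ℝ → ℝ := fun a => if 0 ≤ a then 1 else -1 with hσ
  have hσm : Measurable σ :=
    Measurable.ite measurableSet_Ici measurable_const measurable_const
  have henorm : ∀ p, ‖σ (f p) * H p‖ₑ = ENNReal.ofReal (H p) := fun p => by
    rw [Real.enorm_eq_ofReal_abs, abs_mul, abs_of_nonneg (hH0 p)]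
    by_cases h : 0 ≤ f p <;> simp [hσ, h]
  refine ⟨fun p => σ (f p) * H p, ⟨?_, ?_⟩, fun p => ?_, ?_⟩
  · exact (hσm.comp_aemeasurable hf).mul hHm.aemeasurable
  · have h1 := rearrangement_alignedFunction hmk hw (antitoneOn_zeroExtension hv) n
    have h2 : ∀ᵐ p : ℝ × ℝ, 0 < p.2 → ∀ s > 0, decreasingRearrangement
        (fun x => decreasingRearrangement (fun y => ENNReal.ofReal (H (x, y))) p.2) s =
          ENNReal.ofReal (zeroExtension v p.2) := by
      rw [Measure.volume_eq_prod]
      exact Measure.quasiMeasurePreserving_snd.ae h1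
    filter_upwards [ae_restrict_of_ae h2,
      ae_restrict_mem (measurableSet_Ioi.prod measurableSet_Ioi)] with p h3 h4
    rw [← zeroExtension_of_pos v h4.2, ← h3 h4.2 p.1 h4.1]
    simp only [rearrangement₂, henorm]
  · show 0 ≤ f p * (σ (f p) * H p)
    rw [← mul_assoc]
    refine mul_nonneg ?_ (hH0 p)
    by_cases h : 0 ≤ f p
    · simp [hσ, h]
    · simp only [hσ, h, if_false]
      linarith [not_le.1 h]
  · refine (lintegral_dyadicApprox_le hmk hw n).trans (le_of_eq (lintegral_congr_ae ?_))
    filter_upwards [hf.ae_eq_mk] with p hp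
    rw [← hp, enorm_mul, henorm]

lemma extIntegral_le (g : ℝ × ℝ → ℝ) : extIntegral g ≤ ((∫⁻ p, ‖g p‖ₑ : ℝ≥0∞) : EReal) := by
  refine (EReal.sub_le_of_le_add' ?_)
  refine (EReal.coe_ennreal_le_coe_ennreal_iff.2 (lintegral_mono fun p => ?_)).trans
    (le_add_of_nonneg_left (EReal.coe_ennreal_nonneg _))
  exact Real.ofReal_le_enorm (g p)

lemma lintegral_ofReal_neg_of_nonneg {g : ℝ × ℝ → ℝ} (hg : ∀ p, 0 ≤ g p) :
    ∫⁻ p, ENNReal.ofReal (-g p) = 0 := by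
  simp [ENNReal.ofReal_of_nonpos, hg]

lemma extIntegral_of_nonneg {g : ℝ × ℝ → ℝ} (hg : ∀ p, 0 ≤ g p) :
    extIntegral g = ((∫⁻ p, ‖g p‖ₑ : ℝ≥0∞) : EReal) := by
  rw [extIntegral, lintegral_ofReal_neg_of_nonneg hg, EReal.coe_ennreal_zero, sub_zero]
  simp only [Real.enorm_of_nonneg (hg _)]

theorem mainTheorem11 (v : ℝ → ℝ) (hv : AntitoneOn v (Ioi 0)) (hv0 : ∀ t ∈ Ioi (0 : ℝ), 0 ≤ v t)
    (f : ℝ × ℝ → ℝ) (hf : AEMeasurable f volume) :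
    IsLUB {I : EReal | ∃ h : ℝ × ℝ → ℝ, HasRearrangement₂ h v ∧
        ExtIntegralExists (fun p => f p * h p) ∧ I = extIntegral (fun p => f p * h p)}
      ((∫⁻ p in Ioi (0 : ℝ) ×ˢ Ioi (0 : ℝ),
        rearrangement₂ f p.1 p.2 * ENNReal.ofReal (v p.2) : ℝ≥0∞) : EReal) ∧
    IsLUB {I : ℝ≥0∞ | ∃ h : ℝ × ℝ → ℝ, HasRearrangement₂ h v ∧ I = ∫⁻ p, ‖f p * h p‖ₑ}
      (∫⁻ p in Ioi (0 : ℝ) ×ˢ Ioi (0 : ℝ),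
        rearrangement₂ f p.1 p.2 * ENNReal.ofReal (v p.2)) := by
  have hw := measurable_zeroExtension hv hv0
  have hRHS := iSup_lintegral_dyadicApprox hf.measurable_mk
    (W := fun t => ENNReal.ofReal (zeroExtension v t)) (by fun_prop)
  rw [← lintegral_rearrangement₂_mul hf.measurable_mk hw,
    ← rearrangement₂_congr hf.ae_eq_mk] at hRHS
  refine ⟨⟨?_, fun b hb => ?_⟩, ⟨?_, fun b hb => ?_⟩⟩
  · rintro I ⟨h, hh, -, rfl⟩
    exact (extIntegral_le _).trans
      (EReal.coe_ennreal_le_coe_ennreal_iff.2 (lintegral_enorm_mul_le hf hv hv0 hh))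
  · have hint : ∀ n, ∃ h : ℝ × ℝ → ℝ, ((∫⁻ p, ‖f p * h p‖ₑ : ℝ≥0∞) : EReal) ≤ b ∧
        ∫⁻ x, ∫⁻ t in Ioi (0 : ℝ),
          decreasingRearrangement (fun y => dyadicApprox (hf.mk f) n (x, y)) t *
            ENNReal.ofReal (zeroExtension v t) ≤ ∫⁻ p, ‖f p * h p‖ₑ := fun n => by
      obtain ⟨h, hh, h0, hle⟩ := exists_hasRearrangement₂ hf hv hv0 n
      refine ⟨h, hb ⟨h, hh, Or.inr ?_, (extIntegral_of_nonneg h0).symm⟩, hle⟩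
      rw [lintegral_ofReal_neg_of_nonneg h0]
      exact ENNReal.zero_ne_top
    -- An upper bound dominates one nonnegative integral, so it can be treated as an element of `[0,
    -- ∞]`.
    have hb0 : 0 ≤ b := (EReal.coe_ennreal_nonneg _).trans (hint 0).choose_spec.1
    rw [← EReal.coe_toENNReal hb0, EReal.coe_ennreal_le_coe_ennreal_iff, ← hRHS]
    refine iSup_le fun n => ?_
    obtain ⟨h, hhb, hle⟩ := hint n
    rw [← EReal.coe_toENNReal hb0, EReal.coe_ennreal_le_coe_ennreal_iff] at hhb
    exact hle.trans hhb
  · rintro I ⟨h, hh, rfl⟩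
    exact lintegral_enorm_mul_le hf hv hv0 hh
  · rw [← hRHS]
    refine iSup_le fun n => ?_
    obtain ⟨h, hh, -, hle⟩ := exists_hasRearrangement₂ hf hv hv0 n
    exact hle.trans (hb ⟨h, hh, rfl⟩)
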